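/- Let $\mathcal M$ be a preadditive braided monoidal category that has equalizers, denumerable coproducts and coequalizers of reflexive pairs, and whose tensor products are additive in each variable and preserve equalizers, denumerable coproducts and coequalizers of reflexive pairs (in each variable). Let $\mathrm{Alg}(\mathcal M)$ be the category of algebras (monoids) in $\mathcal M$, $\Omega:\mathrm{Alg}(\mathcal M)\to\mathcal M$ the forgetful functor and $T\dashv\Omega$ its left adjoint, the tensor algebra functor: $\Omega TV=\bigoplus_{n\ge 0}V^{\otimes n}$ with canonical inclusions $\alpha_nV:V^{\otimes n}\to\Omega TV$, unit $\eta V=\alpha_1V$, and counit $\epsilon$ given on $A^{\otimes n}$ by the iterated multiplication of the algebra $A$. Let $\omega:\Omega T\to\mathrm{Id}$ be the projection onto degree one, $\omega V\circ\alpha_nV=\delta_{n,1}\mathrm{Id}_V$. Let $\mathrm{Alg}^+(\mathcal M)=\mathrm{Alg}(\mathcal M)/\mathbf 1$ be the category of augmented algebras $(A,\varepsilon:A\to\mathbf 1)$ and $U:\mathrm{Alg}^+(\mathcal M)\to\mathrm{Alg}(\mathcal M)$ the forgetful functor. Let $T^+V=(TV,\varepsilon_{TV})$, where $\varepsilon_{TV}$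 is the algebra morphism that vanishes on $V$, and let $\Omega^+(A,\varepsilon)=\mathrm{Ker}(\Omega\varepsilon)$ with inclusion $kA:\Omega^+(A,\varepsilon)\to\Omega A$. Then $T^+\dashv\Omega^+$, with unit $\eta^+$ and counit $\epsilon^+$ determined by $kTV\circ\eta^+V=\eta V$ and $U\epsilon^+(A,\varepsilon)=\epsilon A\circ TkA$. As $UT^+=T$, one can define $$\zeta:=\big(\Omega^+\xrightarrow{\ \eta\Omega^+\ }\Omega T\Omega^+=\Omega UT^+\Omega^+\xrightarrow{\ \Omega U\epsilon^+\ }\Omega U\big).$$ An augmentation of a monad $(M,m,u)$ is a natural transformation $\gamma:M\to\mathrm{Id}$ with $\gamma\circ u=\mathrm{Id}$ and $\gamma\circ m=\gamma\gamma$. A functor $L:\mathcal B\to\mathcal A$ is h-separable if there are maps $P_{X,Y}:\mathrm{Hom}(LX,LY)\to\mathrm{Hom}(X,Y)$, natural in $X$ and $Y$, with $P_{X,Y}(Lf)=f$ and $P_{X,Z}(g\circ f)=P_{Y,Z}(g)\circ P_{X,Y}(f)$ for all $f:LX\to LY$ and $g:LY\to LZ$. Then: 1. $\zeta T^+:\Omega^+T^+\to\Omega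 T$ is a morphism of monads from the monad of $T^+\dashv\Omega^+$ to the monad of $T\dashv\Omega$. 2. $\omega^+:=\omega\circ\zeta T^+:\Omega^+T^+\to\mathrm{Id}$ is an augmentation of the monad $(\Omega^+T^+,\Omega^+\epsilon^+T^+,\eta^+)$. 3. Equivalently, $T^+$ is h-separable. The equivalence is the following: a natural transformation $\gamma:\Omega^+T^+\to\mathrm{Id}$ is an augmentation of this monad if and only if the maps $P_{X,Y}(f)=\gamma Y\circ\Omega^+f\circ\eta^+X$, for $f:T^+X\to T^+Y$, make $T^+$ h-separable in the above sense. -/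

import Mathlib

open CategoryTheory MonoidalCategory Limits

noncomputable section

namespace TensorAlg

universe v u

/-! ### Maps out of tensor products with countable coproducts -/

section Coprod

variable {C : Type u} [Category.{v} C] [MonoidalCategory C] [HasCoproductsOfShape ℕ C]

/-- The morphism `X ⊗ ∐ F ⟶ Z` given by its components on `X ⊗ F n`. -/
def descL [∀ X : C, PreservesColimitsOfShape (Discrete ℕ) (tensorLeft X)]
    {X Z : C} {F : ℕ → C} (f : ∀ n, X ⊗ F n ⟶ Z) : X ⊗ (∐ F) ⟶ Z :=
  (PreservesCoproduct.iso (tensorLeft X) F).hom ≫ Sigma.desc f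

/-- The morphism `(∐ F) ⊗ X ⟶ Z` given by its components on `F n ⊗ X`. -/
def descR [∀ X : C, PreservesColimitsOfShape (Discrete ℕ) (tensorRight X)]
    {X Z : C} {F : ℕ → C} (f : ∀ n, F n ⊗ X ⟶ Z) : (∐ F) ⊗ X ⟶ Z :=
  (PreservesCoproduct.iso (tensorRight X) F).hom ≫ Sigma.desc f

theorem ι_descL [∀ X : C, PreservesColimitsOfShape (Discrete ℕ) (tensorLeft X)]
    {X Z : C} {F : ℕ → C} (f : ∀ n, X ⊗ F n ⟶ Z) (n : ℕ) :
    X ◁ Sigma.ι F n ≫ descL f = f n := by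
  have h : X ◁ Sigma.ι F n = Sigma.ι (fun j => X ⊗ F j) n ≫
      (PreservesCoproduct.iso (tensorLeft X) F).inv := by
    rw [PreservesCoproduct.inv_hom]
    exact (ι_comp_sigmaComparison (tensorLeft X) F n).symm
  rw [h, descL, Category.assoc, Iso.inv_hom_id_assoc, Sigma.ι_desc]

theorem ι_descR [∀ X : C, PreservesColimitsOfShape (Discrete ℕ) (tensorRight X)]
    {X Z : C} {F : ℕ → C} (f : ∀ n, F n ⊗ X ⟶ Z) (n : ℕ) :
    Sigma.ι F n ▷ X ≫ descR f = f n := by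
  have h : Sigma.ι F n ▷ X = Sigma.ι (fun j => F j ⊗ X) n ≫
      (PreservesCoproduct.iso (tensorRight X) F).inv := by
    rw [PreservesCoproduct.inv_hom]
    exact (ι_comp_sigmaComparison (tensorRight X) F n).symm
  rw [h, descR, Category.assoc, Iso.inv_hom_id_assoc, Sigma.ι_desc]

theorem extL [∀ X : C, PreservesColimitsOfShape (Discrete ℕ) (tensorLeft X)]
    {X Z : C} {F : ℕ → C} {f g : X ⊗ (∐ F) ⟶ Z}
    (h : ∀ n, X ◁ Sigma.ι F n ≫ f = X ◁ Sigma.ι F n ≫ g) : f = g := by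
  rw [← cancel_epi (PreservesCoproduct.iso (tensorLeft X) F).inv]
  refine Sigma.hom_ext _ _ fun n => ?_
  have := ι_comp_sigmaComparison (tensorLeft X) F n
  rw [PreservesCoproduct.inv_hom, ← Category.assoc, ← Category.assoc, this]
  exact h n

theorem extR [∀ X : C, PreservesColimitsOfShape (Discrete ℕ) (tensorRight X)]
    {X Z : C} {F : ℕ → C} {f g : (∐ F) ⊗ X ⟶ Z}
    (h : ∀ n, Sigma.ι F n ▷ X ≫ f = Sigma.ι F n ▷ X ≫ g) : f = g := by
  rw [← cancel_epi (PreservesCoproduct.iso (tensorRight X) F).inv]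
  refine Sigma.hom_ext _ _ fun n => ?_
  have := ι_comp_sigmaComparison (tensorRight X) F n
  rw [PreservesCoproduct.inv_hom, ← Category.assoc, ← Category.assoc, this]
  exact h n

theorem extLR [∀ X : C, PreservesColimitsOfShape (Discrete ℕ) (tensorLeft X)]
    [∀ X : C, PreservesColimitsOfShape (Discrete ℕ) (tensorRight X)]
    {X Y Z : C} {F : ℕ → C} {f g : X ⊗ ((∐ F) ⊗ Y) ⟶ Z}
    (h : ∀ n, X ◁ (Sigma.ι F n ▷ Y) ≫ f = X ◁ (Sigma.ι F n ▷ Y) ≫ g) : f = g := by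
  rw [← cancel_epi (X ◁ (PreservesCoproduct.iso (tensorRight Y) F).inv)]
  refine extL fun n => ?_
  have := ι_comp_sigmaComparison (tensorRight Y) F n
  rw [PreservesCoproduct.inv_hom, ← Category.assoc, ← Category.assoc,
    ← MonoidalCategory.whiskerLeft_comp, this]
  exact h n

end Coprod

/-! ### Tensor powers and the tensor algebra -/

section Powers

variable {C : Type u} [Category.{v} C] [MonoidalCategory C]

/-- The tensor power `V^{⊗ n}`, bracketed to the left: `V^{⊗ 0} = 𝟙_` and
`V^{⊗ (n+1)} = V^{⊗ n} ⊗ V`; so `V^{⊗ 1} = 𝟙_ ⊗ V`, identified with `V` by the left unitor. -/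
def tpow (V : C) : ℕ → C
  | 0 => 𝟙_ C
  | n + 1 => tpow V n ⊗ V

/-- The canonical isomorphism (written as a morphism) `V^{⊗ m} ⊗ V^{⊗ n} ⟶ V^{⊗ (m+n)}`. -/
def concat (V : C) (m : ℕ) : ∀ n : ℕ, tpow V m ⊗ tpow V n ⟶ tpow V (m + n)
  | 0 => (ρ_ (tpow V m)).hom
  | n + 1 => (α_ (tpow V m) (tpow V n) V).inv ≫ concat V m n ▷ V

/-- The tensor power `f^{⊗ n}` of a morphism. -/
def tpowMap {V W : C} (f : V ⟶ W) : ∀ n : ℕ, tpow V n ⟶ tpow W n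
  | 0 => 𝟙 (𝟙_ C)
  | n + 1 => tpowMap f n ⊗ₘ f

/-- For a morphism `f : V ⟶ A` to an algebra, the morphism `V^{⊗ n} ⟶ A` that is `f^{⊗ n}`
followed by the `n`-fold multiplication of `A`. -/
def powLift {V : C} (A : C) [MonObj A] (f : V ⟶ A) : ∀ n : ℕ, tpow V n ⟶ A
  | 0 => MonObj.one
  | n + 1 => (powLift A f n ⊗ₘ f) ≫ MonObj.mul

/-- The projection of the tensor powers onto degree one: the identity of `V` (up to the
unitor) in degree one, and zero in all other degrees. -/
def powProj [HasZeroMorphisms C] (V : C) : ∀ n : ℕ, tpow V n ⟶ V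
  | 1 => (λ_ V).hom
  | _ => 0

end Powers

section TensorAlgebra

variable {C : Type u} [Category.{v} C] [MonoidalCategory C] [HasCoproductsOfShape ℕ C]

/-- The object `ΩTV = ⨁ₙ V^{⊗ n}` underlying the tensor algebra. -/
def tens (V : C) : C := ∐ (tpow V)

/-- The canonical inclusion `αₙ : V^{⊗ n} ⟶ ΩTV`. -/
def incl (V : C) (n : ℕ) : tpow V n ⟶ tens V := Sigma.ι (tpow V) n

/-- The inclusion of degree zero. -/
def inclZero (V : C) : 𝟙_ C ⟶ tens V := incl V 0

/-- The inclusion `αₙ₊₁`, with domain written as `V^{⊗ n} ⊗ V`. -/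
def inclSucc (V : C) (n : ℕ) : tpow V n ⊗ V ⟶ tens V := incl V (n + 1)

/-- The inclusion `α₁`, with domain written as `𝟙_ ⊗ V`. -/
def inclUnitor (V : C) : 𝟙_ C ⊗ V ⟶ tens V := incl V 1

/-- The inclusion `V ⟶ ΩTV` of degree one. -/
def inclOne (V : C) : V ⟶ tens V := (λ_ V).inv ≫ inclUnitor V

/-- The projection `ΩTV ⟶ V` onto degree one. -/
def projOne [HasZeroMorphisms C] (V : C) : tens V ⟶ V := Sigma.desc (powProj V)

/-- The morphism `ΩTV ⟶ A` induced by a morphism `f : V ⟶ A` to an algebra. -/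
def liftHom {V : C} (A : C) [MonObj A] (f : V ⟶ A) : tens V ⟶ A := Sigma.desc (powLift A f)

theorem incl_liftHom {V : C} (A : C) [MonObj A] (f : V ⟶ A) (n : ℕ) :
    incl V n ≫ liftHom A f = powLift A f n := Sigma.ι_desc _ _

theorem inclZero_liftHom {V : C} (A : C) [MonObj A] (f : V ⟶ A) :
    inclZero V ≫ liftHom A f = MonObj.one := incl_liftHom A f 0

theorem inclSucc_liftHom {V : C} (A : C) [MonObj A] (f : V ⟶ A) (n : ℕ) :
    inclSucc V n ≫ liftHom A f = ((incl V n ≫ liftHom A f) ⊗ₘ f) ≫ MonObj.mul := by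
  rw [incl_liftHom]
  exact incl_liftHom A f (n + 1)

theorem tens_ext {V Z : C} {f g : tens V ⟶ Z} (h : ∀ n, incl V n ≫ f = incl V n ≫ g) : f = g :=
  Sigma.hom_ext _ _ h

variable [∀ X : C, PreservesColimitsOfShape (Discrete ℕ) (tensorLeft X)]
  [∀ X : C, PreservesColimitsOfShape (Discrete ℕ) (tensorRight X)]

/-- The multiplication of the tensor algebra: concatenation of tensor powers. -/
def tmul (V : C) : tens V ⊗ tens V ⟶ tens V :=
  descL fun n => descR fun m => concat V m n ≫ incl V (m + n)

theorem incl_incl_tmul (V : C) (m n : ℕ) :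
    incl V m ▷ tpow V n ≫ tens V ◁ incl V n ≫ tmul V = concat V m n ≫ incl V (m + n) := by
  have h1 := ι_descL (fun n => descR fun m => concat V m n ≫ incl V (m + n)) n
  have h2 := ι_descR (fun m => concat V m n ≫ incl V (m + n)) m
  exact (congrArg (fun t => incl V m ▷ tpow V n ≫ t) h1).trans h2

/-- Right multiplication by `V`. -/
def tstep (V : C) : tens V ⊗ V ⟶ tens V := descR fun n => inclSucc V n

theorem incl_tstep (V : C) (n : ℕ) : incl V n ▷ V ≫ tstep V = inclSucc V n :=
  ι_descR (fun n => inclSucc V n) n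

theorem incl_zero_tmul (V : C) : tens V ◁ inclZero V ≫ tmul V = (ρ_ (tens V)).hom := by
  refine extR fun m => ?_
  refine (incl_incl_tmul V m 0).trans ?_
  exact (rightUnitor_naturality (incl V m)).symm

theorem incl_succ_tmul (V : C) (n : ℕ) : tens V ◁ inclSucc V n ≫ tmul V =
    (α_ (tens V) (tpow V n) V).inv ≫ (tens V ◁ incl V n ≫ tmul V) ▷ V ≫ tstep V := by
  refine extR fun m => ?_
  refine (incl_incl_tmul V m (n + 1)).trans ?_
  have h1 : incl V m ▷ (tpow V n ⊗ V) ≫ (α_ (tens V) (tpow V n) V).inv =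
      (α_ _ _ _).inv ≫ (incl V m ▷ tpow V n) ▷ V := by simp
  change _ = incl V m ▷ (tpow V n ⊗ V) ≫ _
  rw [← Category.assoc (incl V m ▷ (tpow V n ⊗ V)), h1, Category.assoc,
    ← comp_whiskerRight_assoc, incl_incl_tmul, comp_whiskerRight_assoc, incl_tstep]
  refine (Category.assoc _ _ _).trans ?_
  rfl

theorem tstep_tmul (V : C) : tens V ◁ tstep V ≫ tmul V =
    (α_ (tens V) (tens V) V).inv ≫ tmul V ▷ V ≫ tstep V := by
  refine extLR fun n => ?_
  change tens V ◁ (incl V n ▷ V) ≫ _ = tens V ◁ (incl V n ▷ V) ≫ _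
  rw [← MonoidalCategory.whiskerLeft_comp_assoc, incl_tstep, incl_succ_tmul]
  simp

theorem whiskerLeft_inclOne_tmul (V : C) : tens V ◁ inclOne V ≫ tmul V = tstep V := by
  have h : tens V ◁ inclUnitor V ≫ tmul V = (α_ (tens V) (𝟙_ C) V).inv ≫
      (tens V ◁ inclZero V ≫ tmul V) ▷ V ≫ tstep V := incl_succ_tmul V 0
  rw [inclOne, MonoidalCategory.whiskerLeft_comp, Category.assoc, h, incl_zero_tmul]
  simp

theorem inclSucc_eq (V : C) (n : ℕ) : inclSucc V n = (incl V n ⊗ₘ inclOne V) ≫ tmul V := by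
  rw [MonoidalCategory.tensorHom_def, Category.assoc, whiskerLeft_inclOne_tmul, incl_tstep]

theorem tens_one_mul (V : C) : inclZero V ▷ tens V ≫ tmul V = (λ_ (tens V)).hom := by
  refine extL fun n => ?_
  change 𝟙_ C ◁ incl V n ≫ inclZero V ▷ tens V ≫ tmul V = 𝟙_ C ◁ incl V n ≫ _
  rw [leftUnitor_naturality]
  induction n with
  | zero =>
    change 𝟙_ C ◁ inclZero V ≫ inclZero V ▷ tens V ≫ tmul V = (λ_ (𝟙_ C)).hom ≫ inclZero V
    rw [whisker_exchange_assoc, incl_zero_tmul, rightUnitor_naturality, unitors_equal]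
  | succ n ih =>
    change 𝟙_ C ◁ inclSucc V n ≫ inclZero V ▷ tens V ≫ tmul V =
      (λ_ (tpow V n ⊗ V)).hom ≫ inclSucc V n
    rw [← incl_tstep]
    rw [whisker_exchange_assoc, MonoidalCategory.whiskerLeft_comp, Category.assoc, tstep_tmul]
    have : inclZero V ▷ (tpow V n ⊗ V) ≫ tens V ◁ incl V n ▷ V ≫ (α_ _ _ _).inv ≫
        tmul V ▷ V ≫ tstep V = (α_ (𝟙_ C) (tpow V n) V).inv ≫
          (𝟙_ C ◁ incl V n ≫ inclZero V ▷ tens V ≫ tmul V) ▷ V ≫ tstep V := by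
      rw [whisker_exchange_assoc]
      simp
    refine this.trans ?_
    rw [ih]
    simp

theorem tens_mul_assoc (V : C) : tmul V ▷ tens V ≫ tmul V =
    (α_ (tens V) (tens V) (tens V)).hom ≫ tens V ◁ tmul V ≫ tmul V := by
  refine extL fun n => ?_
  change (tens V ⊗ tens V) ◁ incl V n ≫ _ = (tens V ⊗ tens V) ◁ incl V n ≫ _
  have key : ∀ {X : C} (i : X ⟶ tens V), (tens V ⊗ tens V) ◁ i ≫
      (α_ (tens V) (tens V) (tens V)).hom ≫ tens V ◁ tmul V ≫ tmul V = (α_ _ _ _).hom ≫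
        tens V ◁ (tens V ◁ i ≫ tmul V) ≫ tmul V := fun i => by simp
  induction n with
  | zero =>
    change (tens V ⊗ tens V) ◁ inclZero V ≫ _ = (tens V ⊗ tens V) ◁ inclZero V ≫ _
    rw [whisker_exchange_assoc, incl_zero_tmul, key, incl_zero_tmul]
    simp
  | succ n ih =>
    change (tens V ⊗ tens V) ◁ inclSucc V n ≫ _ = (tens V ⊗ tens V) ◁ inclSucc V n ≫ _
    rw [whisker_exchange_assoc, incl_succ_tmul, key, incl_succ_tmul]
    have e1 : tmul V ▷ (tpow V n ⊗ V) ≫ (α_ (tens V) (tpow V n) V).inv ≫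
        (tens V ◁ incl V n ≫ tmul V) ▷ V ≫ tstep V = (α_ _ _ _).inv ≫
        ((tens V ⊗ tens V) ◁ incl V n ≫ tmul V ▷ tens V ≫ tmul V) ▷ V ≫ tstep V := by
      rw [whisker_exchange_assoc]
      simp
    rw [e1, ih, key]
    simp only [MonoidalCategory.whiskerLeft_comp, Category.assoc, tstep_tmul, comp_whiskerRight]
    simp

/-- The algebra structure of the tensor algebra; its unit is the inclusion of degree zero. -/
instance (V : C) : MonObj (tens V) where
  one := inclZero V
  mul := tmul V
  one_mul := tens_one_mul V
  mul_one := incl_zero_tmul V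
  mul_assoc := tens_mul_assoc V

theorem one_tens (V : C) : (MonObj.one : 𝟙_ C ⟶ tens V) = inclZero V := rfl

theorem mul_tens (V : C) : (MonObj.mul : tens V ⊗ tens V ⟶ tens V) = tmul V := rfl

theorem tstep_liftHom {V : C} (A : C) [MonObj A] (f : V ⟶ A) :
    tstep V ≫ liftHom A f = (liftHom A f ⊗ₘ f) ≫ MonObj.mul := by
  refine extR fun n => ?_
  change incl V n ▷ V ≫ _ = incl V n ▷ V ≫ _
  rw [← Category.assoc, incl_tstep, inclSucc_liftHom]
  simp [MonoidalCategory.tensorHom_def]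

instance {V : C} (A : C) [MonObj A] (f : V ⟶ A) : IsMonHom (liftHom A f) where
  one_hom := incl_liftHom A f 0
  mul_hom := by
    rw [mul_tens]
    refine extL fun n => ?_
    change tens V ◁ incl V n ≫ _ = tens V ◁ incl V n ≫ _
    have key : ∀ {X : C} (i : X ⟶ tens V), tens V ◁ i ≫ (liftHom A f ⊗ₘ liftHom A f) ≫
        MonObj.mul = (liftHom A f ⊗ₘ (i ≫ liftHom A f)) ≫ MonObj.mul := fun i => by
      simp [MonoidalCategory.tensorHom_def']
    induction n with
    | zero =>
      change tens V ◁ inclZero V ≫ _ = tens V ◁ inclZero V ≫ _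
      rw [key, ← Category.assoc, incl_zero_tmul, inclZero_liftHom]
      simp
    | succ n ih =>
      change tens V ◁ inclSucc V n ≫ _ = tens V ◁ inclSucc V n ≫ _
      rw [key] at ih ⊢
      rw [← Category.assoc, incl_succ_tmul, Category.assoc, Category.assoc, tstep_liftHom,
        inclSucc_liftHom]
      have h1 : (tens V ◁ incl V n ≫ tmul V) ▷ V ≫ (liftHom A f ⊗ₘ f) ≫ MonObj.mul =
          ((tens V ◁ incl V n ≫ tmul V ≫ liftHom A f) ⊗ₘ f) ≫ MonObj.mul := by
        simp [MonoidalCategory.tensorHom_def]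
      have h2 : (((liftHom A f ⊗ₘ (incl V n ≫ liftHom A f)) ≫ MonObj.mul) ⊗ₘ f) ≫ MonObj.mul =
          ((liftHom A f ⊗ₘ (incl V n ≫ liftHom A f)) ⊗ₘ f) ≫ (MonObj.mul ▷ A) ≫ MonObj.mul := by
        rw [← tensorHom_id, tensorHom_comp_tensorHom_assoc, Category.comp_id]
      have h3 : (liftHom A f ⊗ₘ (((incl V n ≫ liftHom A f) ⊗ₘ f) ≫ MonObj.mul)) ≫ MonObj.mul =
          (liftHom A f ⊗ₘ ((incl V n ≫ liftHom A f) ⊗ₘ f)) ≫ (A ◁ MonObj.mul) ≫ MonObj.mul := by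
        rw [← id_tensorHom, tensorHom_comp_tensorHom_assoc, Category.comp_id]
      rw [h1, ih, h2, h3, MonObj.mul_assoc, associator_naturality_assoc, Iso.inv_hom_id_assoc]

theorem inclOne_liftHom {V : C} (A : C) [MonObj A] (f : V ⟶ A) :
    inclOne V ≫ liftHom A f = f := by
  have h : inclUnitor V ≫ liftHom A f =
      ((inclZero V ≫ liftHom A f) ⊗ₘ f) ≫ MonObj.mul := inclSucc_liftHom A f 0
  rw [inclOne, Category.assoc, h, inclZero_liftHom]
  simp

theorem monHom_ext {V A : C} [MonObj A] {f g : tens V ⟶ A} [IsMonHom f] [IsMonHom g]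
    (h : inclOne V ≫ f = inclOne V ≫ g) : f = g := by
  refine tens_ext fun n => ?_
  induction n with
  | zero => exact (IsMonHom.one_hom f).trans (IsMonHom.one_hom g).symm
  | succ n ih =>
    have e : ∀ (k : tens V ⟶ A) [IsMonHom k], inclSucc V n ≫ k =
        ((incl V n ≫ k) ⊗ₘ (inclOne V ≫ k)) ≫ MonObj.mul := fun k _ => by
      rw [inclSucc_eq, Category.assoc, ← mul_tens, IsMonHom.mul_hom]
      simp
    change inclSucc V n ≫ f = inclSucc V n ≫ g
    rw [e f, e g, ih, h]

/-- The tensor algebra `TV` as an algebra. -/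
def tensAlg (V : C) : Mon C := ⟨tens V⟩

/-- The algebra morphism `TV ⟶ A` that extends `f : V ⟶ A`. -/
def lift {V : C} {A : Mon C} (f : V ⟶ A.X) : tensAlg V ⟶ A :=
  Mon.Hom.mk' (M := tensAlg V) (N := A) (liftHom A.X f)
    (one_f := IsMonHom.one_hom (liftHom A.X f)) (mul_f := IsMonHom.mul_hom (liftHom A.X f))

/-- The inclusion of `V` into its tensor algebra. -/
def unitHom (V : C) : V ⟶ (tensAlg V).X := inclOne V

theorem unitHom_lift {V : C} {A : Mon C} (f : V ⟶ A.X) : unitHom V ≫ (lift f).hom = f :=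
  inclOne_liftHom A.X f

theorem lift_uniq {V : C} {A : Mon C} {f g : tensAlg V ⟶ A}
    (h : unitHom V ≫ f.hom = unitHom V ≫ g.hom) : f = g :=
  Mon.Hom.ext (@monHom_ext _ _ _ _ _ _ V A.X _ f.hom g.hom f.isMonHom_hom g.isMonHom_hom h)

variable (C)

/-- The tensor algebra functor `T`: on morphisms, `Tf` is the algebra morphism that extends `f`. -/
def T : C ⥤ Mon C where
  obj V := tensAlg V
  map {V W} f := lift (f ≫ unitHom W)
  map_id V := lift_uniq (by rw [unitHom_lift]; simp)
  map_comp {V W Z} f g := lift_uniq (by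
    rw [unitHom_lift, Mon.comp_hom', ← Category.assoc, unitHom_lift, Category.assoc, Category.assoc,
      unitHom_lift])

/-- The forgetful functor `Ω` from algebras to `C`. -/
abbrev Ω : Mon C ⥤ C := Mon.forget C

/-- The unit `η V = α₁ V` of the adjunction `T ⊣ Ω`. -/
def η : 𝟭 C ⟶ T C ⋙ Ω C where
  app V := unitHom V
  naturality _ W f := (unitHom_lift (f ≫ unitHom W)).symm

/-- The counit of `T ⊣ Ω`: on `A^{⊗ n}` it is the iterated multiplication of `A`. -/
def ε : Ω C ⋙ T C ⟶ 𝟭 (Mon C) where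
  app A := lift (𝟙 A.X)
  naturality A B f := by
    change lift (f.hom ≫ unitHom B.X) ≫ lift (𝟙 B.X) = lift (𝟙 A.X) ≫ f
    refine lift_uniq ?_
    rw [Mon.comp_hom', Mon.comp_hom', ← Category.assoc, unitHom_lift, Category.assoc, unitHom_lift,
      ← Category.assoc, unitHom_lift, Category.comp_id, Category.id_comp]

/-- The adjunction `T ⊣ Ω`. -/
def adj : T C ⊣ Ω C := Adjunction.mkOfUnitCounit
  { unit := η C
    counit := ε C
    left_triangle := by
      refine NatTrans.ext (funext fun V => ?_)
      simp only [NatTrans.comp_app, Functor.whiskerRight_app, Functor.associator_hom_app,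
        Functor.whiskerLeft_app, Category.id_comp]
      change lift (unitHom V ≫ unitHom (tensAlg V).X) ≫ lift (𝟙 (tensAlg V).X) = 𝟙 (tensAlg V)
      refine lift_uniq ?_
      rw [Mon.comp_hom', ← Category.assoc, unitHom_lift, Category.assoc, unitHom_lift]
      simp
    right_triangle := by
      refine NatTrans.ext (funext fun A => ?_)
      simp only [NatTrans.comp_app, Functor.whiskerRight_app, Functor.associator_inv_app,
        Functor.whiskerLeft_app, Category.id_comp]
      exact unitHom_lift (𝟙 A.X) }

variable {C} in
theorem incl_T_map {V W : C} (f : V ⟶ W) (n : ℕ) :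
    incl V n ≫ liftHom (tens W) (f ≫ inclOne W) = tpowMap f n ≫ incl W n := by
  rw [incl_liftHom]
  induction n with
  | zero => exact (Category.id_comp (inclZero W)).symm
  | succ n ih =>
    change (powLift (tens W) (f ≫ inclOne W) n ⊗ₘ (f ≫ inclOne W)) ≫ tmul W =
      (tpowMap f n ⊗ₘ f) ≫ inclSucc W n
    rw [ih, inclSucc_eq, tensorHom_comp_tensorHom_assoc]

theorem powProj_naturality [HasZeroMorphisms C] {V W : C} (f : V ⟶ W) :
    ∀ n : ℕ, tpowMap f n ≫ powProj W n = powProj V n ≫ f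
  | 0 => comp_zero.trans zero_comp.symm
  | 1 => by
    change (𝟙 (𝟙_ C) ⊗ₘ f) ≫ (λ_ W).hom = (λ_ V).hom ≫ f
    simp
  | _ + 2 => comp_zero.trans zero_comp.symm

/-- The projection `ω : ΩT ⟶ 𝟭` onto degree one. -/
def ω [HasZeroMorphisms C] : T C ⋙ Ω C ⟶ 𝟭 C where
  app V := projOne V
  naturality V W f := by
    refine tens_ext fun n => ?_
    change incl V n ≫ liftHom (tens W) (f ≫ inclOne W) ≫ projOne W =
      incl V n ≫ projOne V ≫ f
    rw [← Category.assoc, incl_T_map, ← Category.assoc (incl V n), Category.assoc]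
    have h : ∀ Z : C, incl Z n ≫ projOne Z = powProj Z n := fun Z => Sigma.ι_desc _ _
    rw [h, h, powProj_naturality]

/-! ### Augmented algebras -/

/-- The category of augmented algebras: algebras `A` with an algebra morphism to `𝟙_`. -/
abbrev AlgPlus : Type (max u v) := Over (Mon.trivial C)

/-- The functor forgetting the augmentation. -/
abbrev U : AlgPlus C ⥤ Mon C := Over.forget (Mon.trivial C)

variable {C} in
/-- The augmentation of `TV`: the algebra morphism to `𝟙_` that is zero on `V`. -/
def augT [HasZeroMorphisms C] (V : C) : tensAlg V ⟶ Mon.trivial C :=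
  lift (V := V) (A := Mon.trivial C) (0 : V ⟶ 𝟙_ C)

variable {C} in
theorem unitHom_augT [HasZeroMorphisms C] (V : C) : unitHom V ≫ (augT V).hom = 0 :=
  unitHom_lift (A := Mon.trivial C) 0

/-- The functor `T⁺` from `C` to augmented algebras, `T⁺V = (TV, ε_{TV})`. -/
def TPlus [HasZeroMorphisms C] : C ⥤ AlgPlus C where
  obj V := Over.mk (augT V)
  map {V W} f := Over.homMk ((T C).map f) (by
    change lift (f ≫ unitHom W) ≫ augT W = augT V
    refine lift_uniq ?_
    rw [Mon.comp_hom', ← Category.assoc, unitHom_lift, Category.assoc, unitHom_augT, unitHom_augT,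
      comp_zero])

variable {C} in
/-- The morphism `Ωε : ΩA ⟶ 𝟙_` underlying the augmentation. -/
def aug (A : AlgPlus C) : A.left.X ⟶ 𝟙_ C := A.hom.hom

variable {C} in
theorem map_aug {A B : AlgPlus C} (f : A ⟶ B) : f.left.hom ≫ aug B = aug A :=
  congrArg Mon.Hom.hom (Over.w f)

/-- The augmentation ideal functor `Ω⁺`, `Ω⁺(A, ε) = Ker (Ωε)`. -/
def ΩPlus [HasZeroMorphisms C] [HasKernels C] : AlgPlus C ⥤ C where
  obj A := kernel (aug A)
  map {A B} f := kernel.lift (aug B) (kernel.ι (aug A) ≫ f.left.hom) (by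
    rw [Category.assoc, map_aug, kernel.condition])

variable {C} in
/-- The inclusion `k A : Ω⁺ A ⟶ Ω A` of the augmentation ideal. -/
def k [HasZeroMorphisms C] [HasKernels C] (A : AlgPlus C) : (ΩPlus C).obj A ⟶ A.left.X :=
  kernel.ι (aug A)

variable {C} in
theorem k_ext [HasZeroMorphisms C] [HasKernels C] {X : C} {A : AlgPlus C}
    {f g : X ⟶ (ΩPlus C).obj A} (h : f ≫ k A = g ≫ k A) : f = g :=
  (cancel_mono (kernel.ι (aug A))).1 h

variable {C} in
theorem k_aug [HasZeroMorphisms C] [HasKernels C] (A : AlgPlus C) : k A ≫ aug A = 0 :=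
  kernel.condition (aug A)

variable {C} in
theorem map_k [HasZeroMorphisms C] [HasKernels C] {A B : AlgPlus C} (f : A ⟶ B) :
    (ΩPlus C).map f ≫ k B = k A ≫ f.left.hom := kernel.lift_ι (aug B) _ _

variable {C} in
/-- The component of `η⁺` at `V`, determined by `k(T⁺V) ∘ η⁺V = ηV`. -/
def ηPlusApp [HasZeroMorphisms C] [HasKernels C] (V : C) : V ⟶ (ΩPlus C).obj ((TPlus C).obj V) :=
  kernel.lift (aug ((TPlus C).obj V)) (unitHom V) (unitHom_augT V)

variable {C} in
theorem ηPlusApp_k [HasZeroMorphisms C] [HasKernels C] (V : C) :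
    ηPlusApp V ≫ k ((TPlus C).obj V) = unitHom V :=
  kernel.lift_ι (aug ((TPlus C).obj V)) _ _

/-- The unit of `T⁺ ⊣ Ω⁺`. -/
def ηPlus [HasZeroMorphisms C] [HasKernels C] : 𝟭 C ⟶ TPlus C ⋙ ΩPlus C where
  app V := ηPlusApp V
  naturality V W f := by
    change f ≫ ηPlusApp W = ηPlusApp V ≫ (ΩPlus C).map ((TPlus C).map f)
    refine k_ext ?_
    rw [Category.assoc, ηPlusApp_k, Category.assoc, map_k, ← Category.assoc, ηPlusApp_k]
    exact (unitHom_lift (f ≫ unitHom W)).symm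

variable {C} in
/-- The algebra morphism `εA ∘ T(kA) : TΩ⁺A ⟶ A`. -/
def evalK [HasZeroMorphisms C] [HasKernels C] (A : AlgPlus C) :
    tensAlg ((ΩPlus C).obj A) ⟶ A.left :=
  (T C).map (k A) ≫ (ε C).app A.left

variable {C} in
theorem unitHom_evalK [HasZeroMorphisms C] [HasKernels C] (A : AlgPlus C) :
    unitHom ((ΩPlus C).obj A) ≫ (evalK A).hom = k A := by
  change unitHom ((ΩPlus C).obj A) ≫ (lift (k A ≫ unitHom A.left.X)).hom ≫
    (lift (𝟙 A.left.X)).hom = k A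
  rw [← Category.assoc, unitHom_lift, Category.assoc, unitHom_lift, Category.comp_id]

/-- The counit of `T⁺ ⊣ Ω⁺`: its underlying algebra morphism is `εA ∘ T(kA)`. -/
def εPlus [HasZeroMorphisms C] [HasKernels C] : ΩPlus C ⋙ TPlus C ⟶ 𝟭 (AlgPlus C) where
  app A := Over.homMk (evalK A) (by
    change evalK A ≫ A.hom = augT ((ΩPlus C).obj A)
    refine lift_uniq ?_
    change unitHom _ ≫ (evalK A).hom ≫ aug A = _
    rw [← Category.assoc, unitHom_evalK, k_aug]
    exact (unitHom_augT ((ΩPlus C).obj A)).symm)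
  naturality A B f := by
    refine Over.OverMorphism.ext ?_
    change lift ((ΩPlus C).map f ≫ unitHom _) ≫ evalK B = evalK A ≫ f.left
    refine lift_uniq ?_
    rw [Mon.comp_hom', Mon.comp_hom', ← Category.assoc, unitHom_lift, Category.assoc,
      unitHom_evalK, ← Category.assoc, unitHom_evalK, map_k]

/-- The adjunction `T⁺ ⊣ Ω⁺`. -/
def adjPlus [HasZeroMorphisms C] [HasKernels C] : TPlus C ⊣ ΩPlus C :=
  Adjunction.mkOfUnitCounit
  { unit := ηPlus C
    counit := εPlus C
    left_triangle := by
      refine NatTrans.ext (funext fun V => ?_)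
      simp only [NatTrans.comp_app, Functor.whiskerRight_app, Functor.associator_hom_app,
        Functor.whiskerLeft_app, Category.id_comp]
      refine Over.OverMorphism.ext ?_
      change lift (ηPlusApp V ≫ unitHom _) ≫ evalK ((TPlus C).obj V) = 𝟙 (tensAlg V)
      refine lift_uniq ?_
      rw [Mon.comp_hom', ← Category.assoc, unitHom_lift, Category.assoc, unitHom_evalK, ηPlusApp_k]
      exact (Category.comp_id (unitHom V)).symm
    right_triangle := by
      refine NatTrans.ext (funext fun A => ?_)
      simp only [NatTrans.comp_app, Functor.whiskerRight_app, Functor.associator_inv_app,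
        Functor.whiskerLeft_app, Category.id_comp]
      change ηPlusApp ((ΩPlus C).obj A) ≫ (ΩPlus C).map ((εPlus C).app A) = 𝟙 ((ΩPlus C).obj A)
      refine k_ext ?_
      rw [Category.assoc, map_k, ← Category.assoc, ηPlusApp_k, Category.id_comp]
      exact unitHom_evalK A }

/-- The natural transformation `ζ : Ω⁺ ⟶ ΩU`, the composite of `ηΩ⁺ : Ω⁺ ⟶ ΩTΩ⁺ = ΩUT⁺Ω⁺` and
`ΩUε⁺ : ΩUT⁺Ω⁺ ⟶ ΩU`. -/
def ζ [HasZeroMorphisms C] [HasKernels C] : ΩPlus C ⟶ U C ⋙ Ω C :=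
  (show ΩPlus C ⟶ (ΩPlus C ⋙ TPlus C) ⋙ U C ⋙ Ω C from Functor.whiskerLeft (ΩPlus C) (η C)) ≫
    Functor.whiskerRight (εPlus C) (U C ⋙ Ω C)

/-- The natural transformation `ζT⁺ : Ω⁺T⁺ ⟶ ΩUT⁺ = ΩT`. -/
def ζT [HasZeroMorphisms C] [HasKernels C] : TPlus C ⋙ ΩPlus C ⟶ T C ⋙ Ω C :=
  Functor.whiskerLeft (TPlus C) (ζ C)

/-- The natural transformation `ω⁺ = ω ∘ ζT⁺ : Ω⁺T⁺ ⟶ 𝟭`. -/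
def ωPlus [HasZeroMorphisms C] [HasKernels C] : TPlus C ⋙ ΩPlus C ⟶ 𝟭 C := ζT C ≫ ω C

end TensorAlgebra

/-! ### Augmentations of monads and h-separable functors -/

section Sep

universe v' u'

variable {B : Type u} [Category.{v} B] {A : Type u'} [Category.{v'} A]

/-- An augmentation of a monad `(M, m, e)`: a natural transformation `γ : M ⟶ 𝟭` such that
`γ ∘ e = 𝟙` and `γ ∘ m = γγ`, where `γγ : MM ⟶ 𝟭` is the horizontal composite, whose
component at `X` is `γ X ∘ γ (M X)`. -/
structure IsAugmentation (M : Monad B) (γ : M.toFunctor ⟶ 𝟭 B) : Prop where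
  unit : ∀ X : B, M.η.app X ≫ γ.app X = 𝟙 X
  mul : ∀ X : B, M.μ.app X ≫ γ.app X = γ.app (M.obj X) ≫ γ.app X

/-- The data that make `L : B ⥤ A` an h-separable (heavily separable) functor: maps
`P : Hom(LX, LY) → Hom(X, Y)`, natural in `X` and `Y`, that are left inverse to the action of `L`
on morphisms and are compatible with composition. -/
structure IsHSeparation (L : B ⥤ A) (P : ∀ X Y : B, (L.obj X ⟶ L.obj Y) → (X ⟶ Y)) : Prop where
  natural : ∀ {X' X Y Y' : B} (a : X' ⟶ X) (f : L.obj X ⟶ L.obj Y) (b : Y ⟶ Y'),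
    P X' Y' (L.map a ≫ f ≫ L.map b) = a ≫ P X Y f ≫ b
  split : ∀ {X Y : B} (f : X ⟶ Y), P X Y (L.map f) = f
  comp : ∀ {X Y Z : B} (f : L.obj X ⟶ L.obj Y) (g : L.obj Y ⟶ L.obj Z),
    P X Z (f ≫ g) = P X Y f ≫ P Y Z g

/-- `L` is h-separable. -/
def IsHSeparable (L : B ⥤ A) : Prop :=
  ∃ P : ∀ X Y : B, (L.obj X ⟶ L.obj Y) → (X ⟶ Y), IsHSeparation L P

end Sep

end TensorAlg

end

/-!
For a functor `U` with `UT⁺ = T`, the mate `ζ` of this identity restricts along `T⁺` to a morphism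
of monads, for any pair of adjunctions; here its components are the inclusions of the augmentation
ideals. The projection `ω` onto degree one is not an augmentation of `ΩT`, because a product with a
factor of degree zero may have a component of degree one. The augmentation ideal of `TV`, however,
is killed by the projection onto degree zero, so products of its elements have no component of
degree one, and the algebra morphism `TW ⟶ TV` that extends some `f` with values in the ideal acts
on degree-one components as `f` does. This is the compatibility of `ω ∘ ζT⁺` with multiplication.
Augmentations and h-separations correspond to each other by transposition along the adjunction.
-/

namespace TensorAlg

universe v u v₁ u₁ v₂ u₂

section HSeparability

variable {B : Type u} [Category.{v} B] {A : Type u₁} [Category.{v₁} A]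
  {L : B ⥤ A} {R : A ⥤ B} {adj : L ⊣ R} {γ : L ⋙ R ⟶ 𝟭 B}

theorem IsAugmentation.app_comp_unit_map_app (h : IsAugmentation adj.toMonad γ) {Y Z : B}
    (g : L.obj Y ⟶ L.obj Z) :
    γ.app Y ≫ adj.unit.app Y ≫ R.map g ≫ γ.app Z = R.map g ≫ γ.app Z := by
  have hmul : R.map (adj.counit.app (L.obj Z)) ≫ γ.app Z = γ.app (R.obj (L.obj Z)) ≫ γ.app Z :=
    h.mul Z
  have hnat : R.map (L.map (adj.unit.app Y ≫ R.map g)) ≫ γ.app (R.obj (L.obj Z)) =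
      γ.app Y ≫ adj.unit.app Y ≫ R.map g := γ.naturality _
  have htranspose : L.map (adj.unit.app Y ≫ R.map g) ≫ adj.counit.app (L.obj Z) = g := by simp
  calc γ.app Y ≫ adj.unit.app Y ≫ R.map g ≫ γ.app Z
      = R.map (L.map (adj.unit.app Y ≫ R.map g)) ≫ γ.app (R.obj (L.obj Z)) ≫ γ.app Z := by
        simp only [reassoc_of% hnat]
    _ = R.map (L.map (adj.unit.app Y ≫ R.map g) ≫ adj.counit.app (L.obj Z)) ≫ γ.app Z := by
        rw [← hmul, R.map_comp_assoc]
    _ = R.map g ≫ γ.app Z := by rw [htranspose]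

theorem IsAugmentation.isHSeparation (h : IsAugmentation adj.toMonad γ) :
    IsHSeparation L fun X Y f => adj.unit.app X ≫ R.map f ≫ γ.app Y where
  natural {X' X Y Y'} a f b := by
    have hb : R.map (L.map b) ≫ γ.app Y' = γ.app Y ≫ b := γ.naturality b
    simp [hb]
  split {X Y} f := by
    have hunit : adj.unit.app Y ≫ γ.app Y = 𝟙 Y := h.unit Y
    simp [hunit]
  comp f g := by
    simp only [Functor.map_comp, Category.assoc, h.app_comp_unit_map_app]

theorem IsHSeparation.isAugmentation
    (h : IsHSeparation L fun X Y f => adj.unit.app X ≫ R.map f ≫ γ.app Y) :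
    IsAugmentation adj.toMonad γ where
  unit X := by
    change adj.unit.app X ≫ γ.app X = 𝟙 X
    simpa using h.split (𝟙 X)
  mul X := by
    change R.map (adj.counit.app (L.obj X)) ≫ γ.app X = γ.app (R.obj (L.obj X)) ≫ γ.app X
    simpa using h.comp (adj.counit.app (L.obj (R.obj (L.obj X)))) (adj.counit.app (L.obj X))

theorem isAugmentation_iff_isHSeparation (adj : L ⊣ R) (γ : L ⋙ R ⟶ 𝟭 B) :
    IsAugmentation adj.toMonad γ ↔
      IsHSeparation L fun X Y f => adj.unit.app X ≫ R.map f ≫ γ.app Y :=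
  ⟨IsAugmentation.isHSeparation, IsHSeparation.isAugmentation⟩

theorem IsAugmentation.isHSeparable (h : IsAugmentation adj.toMonad γ) : IsHSeparable L :=
  ⟨_, h.isHSeparation⟩

theorem IsAugmentation.comp_monadHom {N M : Monad B} (φ : N ⟶ M) {δ : M.toFunctor ⟶ 𝟭 B}
    (unit : ∀ X, M.η.app X ≫ δ.app X = 𝟙 X)
    (mul : ∀ X, M.map (φ.app X) ≫ M.μ.app X ≫ δ.app X = δ.app (N.obj X) ≫ φ.app X ≫ δ.app X) :
    IsAugmentation N (φ.toNatTrans ≫ δ) where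
  unit X := by simp [unit]
  mul X := by
    have hnat : N.map (φ.app X) ≫ φ.app (M.obj X) = φ.app (N.obj X) ≫ M.map (φ.app X) :=
      φ.naturality (φ.app X)
    simp [reassoc_of% hnat, mul]

end HSeparability

section Comparison

variable {B : Type u} [Category.{v} B] {A : Type u₁} [Category.{v₁} A]
  {A₁ : Type u₂} [Category.{v₂} A₁] {L : B ⥤ A} {R : A ⥤ B} {L₁ : B ⥤ A₁} {R₁ : A₁ ⥤ B}
  (adj₁ : L₁ ⊣ R₁) (adj : L ⊣ R) (U : A₁ ⥤ A) (e : L₁ ⋙ U ≅ L)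

/-- For a functor `U` with `L₁ ⋙ U ≅ L`, the comparison `L₁ ⋙ R₁ ⟶ L ⋙ R`, written in components:
the mate `R₁ ⟶ U ⋙ R` of the isomorphism, evaluated on the image of `L₁`. -/
def comparisonApp (X : B) : R₁.obj (L₁.obj X) ⟶ R.obj (L.obj X) :=
  adj.homEquiv (R₁.obj (L₁.obj X)) (L.obj X)
    (e.inv.app (R₁.obj (L₁.obj X)) ≫ U.map (adj₁.counit.app (L₁.obj X)) ≫ e.hom.app X)

theorem homEquiv_comp_comparisonApp {W X : B} (t : L₁.obj W ⟶ L₁.obj X) :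
    adj₁.homEquiv W (L₁.obj X) t ≫ comparisonApp adj₁ adj U e X =
      adj.homEquiv W (L.obj X) (e.inv.app W ≫ U.map t ≫ e.hom.app X) := by
  have he : L.map (adj₁.homEquiv W (L₁.obj X) t) ≫ e.inv.app (R₁.obj (L₁.obj X)) =
      e.inv.app W ≫ U.map (L₁.map (adj₁.homEquiv W (L₁.obj X) t)) := e.inv.naturality _
  have ht : L₁.map (adj₁.homEquiv W (L₁.obj X) t) ≫ adj₁.counit.app (L₁.obj X) = t :=
    (adj₁.homEquiv_counit ..).symm.trans ((adj₁.homEquiv W (L₁.obj X)).symm_apply_apply t)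
  rw [comparisonApp, ← adj.homEquiv_naturality_left, reassoc_of% he, ← U.map_comp_assoc, ht]

theorem unit_comp_comparisonApp (X : B) :
    adj₁.unit.app X ≫ comparisonApp adj₁ adj U e X = adj.unit.app X := by
  have he : e.inv.app X ≫ U.map (𝟙 (L₁.obj X)) ≫ e.hom.app X = 𝟙 (L.obj X) := by
    rw [U.map_id]
    exact (congrArg (e.inv.app X ≫ ·) (Category.id_comp _)).trans (e.inv_hom_id_app X)
  have h := homEquiv_comp_comparisonApp adj₁ adj U e (𝟙 (L₁.obj X))
  rwa [he, adj₁.homEquiv_id, adj.homEquiv_id] at h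

theorem map_comp_comparisonApp {X Y : B} (t : L₁.obj X ⟶ L₁.obj Y) :
    R₁.map t ≫ comparisonApp adj₁ adj U e Y =
      comparisonApp adj₁ adj U e X ≫ R.map (e.inv.app X ≫ U.map t ≫ e.hom.app Y) := by
  have ht : R₁.map t = adj₁.homEquiv _ _ (adj₁.counit.app (L₁.obj X) ≫ t) := by
    simp [adj₁.homEquiv_unit]
  have he : e.hom.app X ≫ e.inv.app X = 𝟙 (U.obj (L₁.obj X)) := e.hom_inv_id_app X
  rw [ht, homEquiv_comp_comparisonApp, comparisonApp, ← adj.homEquiv_naturality_right]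
  simp only [U.map_comp, Category.assoc, reassoc_of% he]

theorem comparisonApp_naturality {X Y : B} (f : X ⟶ Y) :
    R₁.map (L₁.map f) ≫ comparisonApp adj₁ adj U e Y =
      comparisonApp adj₁ adj U e X ≫ R.map (L.map f) := by
  have he : e.inv.app X ≫ U.map (L₁.map f) ≫ e.hom.app Y = L.map f := NatIso.naturality_1 e f
  rw [map_comp_comparisonApp, he]

theorem map_counit_comp_comparisonApp (X : B) :
    R₁.map (adj₁.counit.app (L₁.obj X)) ≫ comparisonApp adj₁ adj U e X =
      R₁.map (L₁.map (comparisonApp adj₁ adj U e X)) ≫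
        comparisonApp adj₁ adj U e (R.obj (L.obj X)) ≫ R.map (adj.counit.app (L.obj X)) := by
  have htranspose : L.map (comparisonApp adj₁ adj U e X) ≫ adj.counit.app (L.obj X) =
      e.inv.app (R₁.obj (L₁.obj X)) ≫ U.map (adj₁.counit.app (L₁.obj X)) ≫ e.hom.app X :=
    (adj.homEquiv_counit ..).symm.trans ((adj.homEquiv _ _).symm_apply_apply _)
  rw [← Category.assoc, comparisonApp_naturality, Category.assoc, ← R.map_comp, htranspose]
  exact map_comp_comparisonApp adj₁ adj U e (adj₁.counit.app (L₁.obj X))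

/-- The comparison `L₁ ⋙ R₁ ⟶ L ⋙ R` as a morphism from the monad of `L₁ ⊣ R₁` to the monad of
`L ⊣ R`. -/
def comparisonMonadHom : adj₁.toMonad ⟶ adj.toMonad :=
  show MonadHom adj₁.toMonad adj.toMonad from
  { app := comparisonApp adj₁ adj U e
    naturality := fun _ _ f => comparisonApp_naturality adj₁ adj U e f
    app_η := unit_comp_comparisonApp adj₁ adj U e
    app_μ := fun X => (map_counit_comp_comparisonApp adj₁ adj U e X).trans
      (Category.assoc _ _ _).symm }

end Comparison

section CopowerPreserving

variable {C : Type u} [Category.{v} C] {D : Type u₁} [Category.{v₁} D] [HasZeroMorphisms D]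

-- All coprojections of the copower `∐_ι X` of a zero object `X` are the identity of `X`; a
-- coproduct of nonzero objects cannot have two equal coprojections.
theorem isZero_obj_of_preservesColimitsOfShape_discrete (ι : Type*) [Nontrivial ι] (F : C ⥤ D)
    [PreservesColimitsOfShape (Discrete ι) F] {X : C} (hX : IsZero X) : IsZero (F.obj X) := by
  classical
  obtain ⟨i, j, hij⟩ := exists_pair_ne ι
  have hcopower : IsColimit (Cofan.mk X fun _ : ι => 𝟙 X) :=
    Cofan.IsColimit.mk _ (fun t => hX.to_ t.pt) (fun _ _ => hX.eq_of_src _ _)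
      fun _ _ _ => hX.eq_of_src _ _
  have hmap := isColimitCofanMkObjOfIsColimit F _ _ hcopower
  let f : F.obj X ⟶ F.obj X :=
    Cofan.IsColimit.desc hmap fun n => if n = i then 𝟙 (F.obj X) else 0
  have hi : F.map (𝟙 X) ≫ f = 𝟙 (F.obj X) :=
    (Cofan.IsColimit.fac hmap _ i).trans (if_pos rfl)
  have hj : F.map (𝟙 X) ≫ f = 0 := (Cofan.IsColimit.fac hmap _ j).trans (if_neg hij.symm)
  exact (IsZero.iff_id_eq_zero _).2 (hi.symm.trans hj)

theorem preservesZeroMorphisms_of_preservesColimitsOfShape_discrete [HasZeroMorphisms C]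
    [HasKernels C] (ι : Type*) [Nontrivial ι] (F : C ⥤ D)
    [PreservesColimitsOfShape (Discrete ι) F] : F.PreservesZeroMorphisms where
  map_zero X Y := by
    have hzero : IsZero (F.obj (kernel (𝟙 X))) :=
      isZero_obj_of_preservesColimitsOfShape_discrete ι F (isZero_kernel_of_mono (𝟙 X))
    rw [← zero_comp (X := X) (f := (0 : kernel (𝟙 X) ⟶ Y)), F.map_comp,
      hzero.eq_zero_of_src (F.map 0), comp_zero]

end CopowerPreserving

section ZeroMorphisms

variable {C : Type u} [Category.{v} C] [MonoidalCategory C] [HasZeroMorphisms C]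

theorem whiskerLeft_zero [∀ X : C, (tensorLeft X).PreservesZeroMorphisms] {X Y Z : C} :
    X ◁ (0 : Y ⟶ Z) = 0 :=
  (tensorLeft X).map_zero Y Z

theorem zero_whiskerRight [∀ X : C, (tensorRight X).PreservesZeroMorphisms] {X Y Z : C} :
    (0 : X ⟶ Y) ▷ Z = 0 :=
  (tensorRight Z).map_zero X Y

theorem tensorHom_zero [∀ X : C, (tensorLeft X).PreservesZeroMorphisms] {W X Y Z : C}
    (f : W ⟶ X) : f ⊗ₘ (0 : Y ⟶ Z) = 0 := by
  rw [MonoidalCategory.tensorHom_def, whiskerLeft_zero, comp_zero]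

theorem zero_tensorHom [∀ X : C, (tensorRight X).PreservesZeroMorphisms] {W X Y Z : C}
    (f : W ⟶ X) : (0 : Y ⟶ Z) ⊗ₘ f = 0 := by
  rw [MonoidalCategory.tensorHom_def, zero_whiskerRight, zero_comp]

end ZeroMorphisms

section Tens

variable {C : Type u} [Category.{v} C] [MonoidalCategory C] [HasCoproductsOfShape ℕ C]

theorem tens_hom_ext {V Z : C} {f g : tens V ⟶ Z} (zero : inclZero V ≫ f = inclZero V ≫ g)
    (one : inclOne V ≫ f = inclOne V ≫ g)
    (succ_succ : ∀ n, inclSucc V (n + 1) ≫ f = inclSucc V (n + 1) ≫ g) : f = g :=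
  tens_ext fun
    | 0 => zero
    | 1 => have h : inclUnitor V ≫ f = inclUnitor V ≫ g :=
        (cancel_epi (λ_ V).inv).1 (by simpa only [inclOne, Category.assoc] using one)
      h
    | n + 2 => succ_succ n

theorem whiskerRight_tens_hom_ext
    [∀ X : C, PreservesColimitsOfShape (Discrete ℕ) (tensorRight X)]
    {V X Z : C} {f g : tens V ⊗ X ⟶ Z} (zero : inclZero V ▷ X ≫ f = inclZero V ▷ X ≫ g)
    (succ : ∀ n, inclSucc V n ▷ X ≫ f = inclSucc V n ▷ X ≫ g) : f = g :=
  extR fun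
    | 0 => zero
    | n + 1 => succ n

theorem whiskerLeft_tens_hom_ext
    [∀ X : C, PreservesColimitsOfShape (Discrete ℕ) (tensorLeft X)]
    {V X Z : C} {f g : X ⊗ tens V ⟶ Z} (zero : X ◁ inclZero V ≫ f = X ◁ inclZero V ≫ g)
    (succ : ∀ n, X ◁ inclSucc V n ≫ f = X ◁ inclSucc V n ≫ g) : f = g :=
  extL fun
    | 0 => zero
    | n + 1 => succ n

variable [HasZeroMorphisms C]

theorem inclZero_projOne (V : C) : inclZero V ≫ projOne V = 0 :=
  Sigma.ι_desc (powProj V) 0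

theorem inclUnitor_projOne (V : C) : inclUnitor V ≫ projOne V = (λ_ V).hom :=
  Sigma.ι_desc (powProj V) 1

theorem inclSucc_succ_projOne (V : C) (n : ℕ) : inclSucc V (n + 1) ≫ projOne V = 0 :=
  Sigma.ι_desc (powProj V) (n + 2)

theorem inclOne_projOne (V : C) : inclOne V ≫ projOne V = 𝟙 V := by
  rw [inclOne, Category.assoc, inclUnitor_projOne, Iso.inv_hom_id]

/-- The projection `ΩTV ⟶ 𝟙_` onto degree zero, which underlies the augmentation of `TV`. -/
noncomputable def projZero (V : C) : tens V ⟶ 𝟙_ C := liftHom (𝟙_ C) 0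

theorem inclZero_projZero (V : C) : inclZero V ≫ projZero V = 𝟙 (𝟙_ C) :=
  inclZero_liftHom (𝟙_ C) 0

theorem inclSucc_projZero [∀ X : C, (tensorLeft X).PreservesZeroMorphisms] (V : C) (n : ℕ) :
    inclSucc V n ≫ projZero V = 0 := by
  rw [projZero, inclSucc_liftHom, tensorHom_zero, zero_comp]

variable [∀ X : C, PreservesColimitsOfShape (Discrete ℕ) (tensorLeft X)]
  [∀ X : C, PreservesColimitsOfShape (Discrete ℕ) (tensorRight X)]

instance (V : C) : IsMonHom (projZero V) :=
  inferInstanceAs (IsMonHom (liftHom (𝟙_ C) 0))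

theorem tensorHom_tmul_projZero {V W X : C} (f : W ⟶ tens V) (g : X ⟶ tens V) :
    (f ⊗ₘ g) ≫ tmul V ≫ projZero V =
      ((f ≫ projZero V) ⊗ₘ (g ≫ projZero V)) ≫ (λ_ (𝟙_ C)).hom := by
  have h : tmul V ≫ projZero V = (projZero V ⊗ₘ projZero V) ≫ (λ_ (𝟙_ C)).hom :=
    IsMonHom.mul_hom (projZero V)
  rw [h, tensorHom_comp_tensorHom_assoc]

theorem liftHom_projZero {V W : C} {f : W ⟶ tens V} (hf : f ≫ projZero V = 0) :
    liftHom (tens V) f ≫ projZero V = projZero W :=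
  monHom_ext (by
    rw [← Category.assoc, inclOne_liftHom, hf, projZero, inclOne_liftHom])

variable [∀ X : C, (tensorLeft X).PreservesZeroMorphisms]
  [∀ X : C, (tensorRight X).PreservesZeroMorphisms]

theorem tstep_projOne (V : C) : tstep V ≫ projOne V = projZero V ▷ V ≫ (λ_ V).hom := by
  refine whiskerRight_tens_hom_ext ?_ fun n => ?_
  · have h : inclZero V ▷ V ≫ tstep V = inclUnitor V := incl_tstep V 0
    rw [reassoc_of% h, inclUnitor_projOne, ← comp_whiskerRight_assoc, inclZero_projZero,
      id_whiskerRight, Category.id_comp]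
  · have h : inclSucc V n ▷ V ≫ tstep V ≫ projOne V = 0 := by
      rw [← Category.assoc]
      exact (congrArg (· ≫ projOne V) (incl_tstep V (n + 1))).trans (inclSucc_succ_projOne V n)
    rw [h, ← comp_whiskerRight_assoc, inclSucc_projZero, zero_whiskerRight, zero_comp]

theorem whiskerRight_tmul_projOne {V W : C} {f : W ⟶ tens V} (hf : f ≫ projZero V = 0) :
    f ▷ tens V ≫ tmul V ≫ projOne V = ((f ≫ projOne V) ⊗ₘ projZero V) ≫ (ρ_ V).hom := by
  refine whiskerLeft_tens_hom_ext ?_ fun n => ?_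
  · calc W ◁ inclZero V ≫ f ▷ tens V ≫ tmul V ≫ projOne V
        = f ▷ 𝟙_ C ≫ (tens V ◁ inclZero V ≫ tmul V) ≫ projOne V := by
          rw [whisker_exchange_assoc, Category.assoc]
      _ = (f ≫ projOne V) ▷ 𝟙_ C ≫ (ρ_ V).hom := by
          simp [incl_zero_tmul]
      _ = W ◁ inclZero V ≫ ((f ≫ projOne V) ⊗ₘ projZero V) ≫ (ρ_ V).hom := by
          rw [MonoidalCategory.tensorHom_def', Category.assoc, ← whiskerLeft_comp_assoc,
            inclZero_projZero, whiskerLeft_id, Category.id_comp]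
  · calc W ◁ inclSucc V n ≫ f ▷ tens V ≫ tmul V ≫ projOne V
        = f ▷ (tpow V n ⊗ V) ≫ (tens V ◁ inclSucc V n ≫ tmul V) ≫ projOne V := by
          rw [whisker_exchange_assoc, Category.assoc]
      _ = (α_ W (tpow V n) V).inv ≫
            ((f ⊗ₘ incl V n) ≫ tmul V ≫ projZero V) ▷ V ≫ (λ_ V).hom := by
          simp [incl_succ_tmul, tstep_projOne, MonoidalCategory.tensorHom_def]
      _ = 0 := by
          simp only [tensorHom_tmul_projZero, hf, zero_tensorHom, zero_whiskerRight, zero_comp,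
            comp_zero]
      _ = W ◁ inclSucc V n ≫ ((f ≫ projOne V) ⊗ₘ projZero V) ≫ (ρ_ V).hom := by
          rw [MonoidalCategory.tensorHom_def', Category.assoc, ← whiskerLeft_comp_assoc,
            inclSucc_projZero, whiskerLeft_zero, zero_comp]

theorem tensorHom_tmul_projOne {V W X : C} {f : W ⟶ tens V} {g : X ⟶ tens V}
    (hf : f ≫ projZero V = 0) (hg : g ≫ projZero V = 0) :
    (f ⊗ₘ g) ≫ tmul V ≫ projOne V = 0 := by
  rw [MonoidalCategory.tensorHom_def', Category.assoc, whiskerRight_tmul_projOne hf,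
    ← id_tensorHom, tensorHom_comp_tensorHom_assoc, hg, tensorHom_zero, zero_comp]

theorem liftHom_projOne {V W : C} {f : W ⟶ tens V} (hf : f ≫ projZero V = 0) :
    liftHom (tens V) f ≫ projOne V = projOne W ≫ f ≫ projOne V := by
  refine tens_hom_ext ?_ ?_ fun n => ?_
  · rw [← Category.assoc, inclZero_liftHom, one_tens, inclZero_projOne, ← Category.assoc,
      inclZero_projOne, zero_comp]
  · rw [← Category.assoc, inclOne_liftHom, ← Category.assoc, inclOne_projOne, Category.id_comp]
  · have hker : (inclSucc W n ≫ liftHom (tens V) f) ≫ projZero V = 0 := by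
      rw [Category.assoc, liftHom_projZero hf, inclSucc_projZero]
    have hleft : inclSucc W (n + 1) ≫ liftHom (tens V) f ≫ projOne V = 0 := by
      rw [← Category.assoc, inclSucc_liftHom, Category.assoc]
      exact tensorHom_tmul_projOne hker hf
    rw [hleft, ← Category.assoc, inclSucc_succ_projOne, zero_comp]

end Tens

section AugmentedAlgebras

variable (C : Type u) [Category.{v} C] [MonoidalCategory C] [HasCoproductsOfShape ℕ C]
  [∀ X : C, PreservesColimitsOfShape (Discrete ℕ) (tensorLeft X)]
  [∀ X : C, PreservesColimitsOfShape (Discrete ℕ) (tensorRight X)]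

variable {C} in
theorem T_map_comp_ε {V : C} {A : Mon C} (f : V ⟶ A.X) : (T C).map f ≫ (ε C).app A = lift f :=
  ((adj C).homEquiv_counit ..).symm.trans <|
    ((adj C).homEquiv V A).symm_apply_eq.2 (unitHom_lift f).symm

variable [HasZeroMorphisms C] [HasKernels C]

variable {C} in
theorem ζ_app (A : AlgPlus C) : (ζ C).app A = k A :=
  unitHom_evalK A

/-- The natural transformation `ζT⁺` as a morphism of monads. -/
noncomputable def ζTMonadHom : (adjPlus C).toMonad ⟶ (adj C).toMonad :=
  comparisonMonadHom (adjPlus C) (adj C) (U C) (Iso.refl (T C))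

theorem toNatTrans_ζTMonadHom : (ζTMonadHom C).toNatTrans = ζT C := by
  ext V
  exact congrArg (fun f => (η C).app _ ≫ (Ω C).map f)
    ((Category.id_comp _).trans (Category.comp_id ((U C).map ((εPlus C).app ((TPlus C).obj V)))))

theorem isAugmentation_ωPlus : IsAugmentation (adjPlus C).toMonad (ωPlus C) := by
  have hleft (X : C) : (tensorLeft X).PreservesZeroMorphisms :=
    preservesZeroMorphisms_of_preservesColimitsOfShape_discrete ℕ _
  have hright (X : C) : (tensorRight X).PreservesZeroMorphisms :=
    preservesZeroMorphisms_of_preservesColimitsOfShape_discrete ℕ _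
  have hk (V : C) : (ζTMonadHom C).app V = k ((TPlus C).obj V) :=
    (congrArg (·.app V) (toNatTrans_ζTMonadHom C)).trans (ζ_app ((TPlus C).obj V))
  have h : IsAugmentation (adjPlus C).toMonad ((ζTMonadHom C).toNatTrans ≫ ω C) := by
    refine IsAugmentation.comp_monadHom (ζTMonadHom C) inclOne_projOne fun V => ?_
    have hlift : ((T C).map (k ((TPlus C).obj V))).hom ≫ ((ε C).app ((T C).obj V)).hom =
        liftHom (tens V) (k ((TPlus C).obj V)) := congrArg Mon.Hom.hom (T_map_comp_ε _)
    rw [hk]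
    exact (Category.assoc _ _ _).symm.trans <| (congrArg (· ≫ projOne V) hlift).trans <|
      liftHom_projOne (k_aug ((TPlus C).obj V))
  rwa [toNatTrans_ζTMonadHom] at h

end AugmentedAlgebras

end TensorAlg

theorem mainTheorem10_general {M : Type*} [Category* M] [MonoidalCategory M] [HasZeroMorphisms M]
    [HasKernels M] [HasCoproductsOfShape ℕ M]
    [∀ X : M, PreservesColimitsOfShape (Discrete ℕ) (tensorLeft X)]
    [∀ X : M, PreservesColimitsOfShape (Discrete ℕ) (tensorRight X)] :
    (∃ φ : (TensorAlg.adjPlus M).toMonad ⟶ (TensorAlg.adj M).toMonad,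
      φ.toNatTrans = TensorAlg.ζT M) ∧
    TensorAlg.IsAugmentation (TensorAlg.adjPlus M).toMonad (TensorAlg.ωPlus M) ∧
    TensorAlg.IsHSeparable (TensorAlg.TPlus M) ∧
    (∀ γ : TensorAlg.TPlus M ⋙ TensorAlg.ΩPlus M ⟶ 𝟭 M,
      TensorAlg.IsAugmentation (TensorAlg.adjPlus M).toMonad γ ↔
        TensorAlg.IsHSeparation (TensorAlg.TPlus M) fun X Y f =>
          (TensorAlg.adjPlus M).unit.app X ≫ (TensorAlg.ΩPlus M).map f ≫ γ.app Y) :=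
  have haug := TensorAlg.isAugmentation_ωPlus M
  ⟨⟨TensorAlg.ζTMonadHom M, TensorAlg.toNatTrans_ζTMonadHom M⟩, haug, haug.isHSeparable,
    TensorAlg.isAugmentation_iff_isHSeparation (TensorAlg.adjPlus M)⟩

theorem mainTheorem10 {M : Type*} [Category* M] [Preadditive M] [MonoidalCategory M]
    [BraidedCategory M] [MonoidalPreadditive M]
    [HasEqualizers M] [HasCoproductsOfShape ℕ M] [HasReflexiveCoequalizers M]
    [∀ X : M, PreservesLimitsOfShape WalkingParallelPair (tensorLeft X)]
    [∀ X : M, PreservesLimitsOfShape WalkingParallelPair (tensorRight X)]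
    [∀ X : M, PreservesColimitsOfShape (Discrete ℕ) (tensorLeft X)]
    [∀ X : M, PreservesColimitsOfShape (Discrete ℕ) (tensorRight X)]
    [∀ X : M, Monad.PreservesColimitOfIsReflexivePair (tensorLeft X)]
    [∀ X : M, Monad.PreservesColimitOfIsReflexivePair (tensorRight X)] :
    (∃ φ : (TensorAlg.adjPlus M).toMonad ⟶ (TensorAlg.adj M).toMonad, φ.toNatTrans = TensorAlg.ζT M) ∧
    TensorAlg.IsAugmentation (TensorAlg.adjPlus M).toMonad (TensorAlg.ωPlus M) ∧
    TensorAlg.IsHSeparable (TensorAlg.TPlus M) ∧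
    (∀ γ : TensorAlg.TPlus M ⋙ TensorAlg.ΩPlus M ⟶ 𝟭 M,
      TensorAlg.IsAugmentation (TensorAlg.adjPlus M).toMonad γ ↔
        TensorAlg.IsHSeparation (TensorAlg.TPlus M) fun X Y f =>
          (TensorAlg.adjPlus M).unit.app X ≫ (TensorAlg.ΩPlus M).map f ≫ γ.app Y) :=
  mainTheorem10_general
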